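/- Let $k$ be a field, let $n \ge 3$ and $t \ge 1$ be integers, and let $R = k[x_1,\dots,x_n]$. For $1 \le i \le n$ put $\mathbf{x}^{e_i} = x_1^t\cdots x_{i-1}^t x_{i+1}^t\cdots x_n^t$, and let $I_{n,t} = \langle \mathbf{x}^{e_1},\dots,\mathbf{x}^{e_n}\rangle \subseteq R$. Then: (a) $I_{n,t} = \bigcap_{1 \le i<j \le n} \langle x_i^t, x_j^t\rangle$. The components $\langle x_i^t,x_j^t\rangle$ ($i<j$) are pairwise distinct, and this is a minimal primary decomposition: each component is primary, their radicals are pairwise distinct, and no component contains the intersection of the others. (b) $I_{n,t}$ has no embedded primes, i.e. every associated prime of $R/I_{n,t}$ is a minimal prime of $I_{n,t}$; and $\operatorname{codim}(I_{n,t}) = 2$, where the codimension is the height. (c) Let $A = (\mathbf{x}^{e_1}\ \cdots\ \mathbf{x}^{e_n})$, a $1\times n$ matrix, and let $B$ be the $n\times(n-1)$ matrix whose first row is $(-x_1^t,\dots,-x_1^t)$ and whose remaining $n-1$ rows form the diagonal matrix with diagonal entries $x_2^t,\dots,x_n^t$. Then $$0 \leftarrow R/I_{n,t} \leftarrow R \xleftarrow{\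 A\ } R^n \xleftarrow{\ B\ } R^{n-1} \leftarrow 0,$$ where $R \to R/I_{n,t}$ is the quotient map, is a minimal graded free resolution of $R/I_{n,t}$: it is exact, it is graded for a suitable choice of degrees of the basis vectors, and all entries of $A$ and $B$ lie in $\langle x_1,\dots,x_n\rangle$. (d) The projective dimension of the $R$-module $R/I_{n,t}$ is $2$, and it equals $\operatorname{codim}(I_{n,t})$. (e) $I_{n,t}$ is Cohen–Macaulay, i.e. $R/I_{n,t}$ is a Cohen–Macaulay ring: it is Noetherian, and its localization at each maximal ideal has depth equal to its Krull dimension. -/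

import Mathlib

namespace PowerIdeal

/-- The depth of a local ring `A`: the supremum of the lengths of the `A`-regular sequences
contained in the maximal ideal. -/
noncomputable def localDepth (A : Type*) [CommRing A] [IsLocalRing A] : ℕ∞ :=
  ⨆ (rs : List A) (_ : (∀ r ∈ rs, r ∈ IsLocalRing.maximalIdeal A) ∧
    RingTheory.Sequence.IsRegular A rs), (rs.length : ℕ∞)

/-- A Noetherian local ring is Cohen–Macaulay if its depth equals its Krull dimension. -/
structure IsCohenMacaulayLocalRing (A : Type*) [CommRing A] [IsLocalRing A] : Prop where
  noetherian : IsNoetherianRing A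
  depth_eq_dim : (localDepth A : WithBot ℕ∞) = ringKrullDim A

/-- A Noetherian ring is Cohen–Macaulay if its localization at every maximal ideal is a
Cohen–Macaulay local ring. -/
structure IsCohenMacaulayRing (A : Type*) [CommRing A] : Prop where
  noetherian : IsNoetherianRing A
  localization : ∀ (m : Ideal A) [m.IsMaximal],
    IsCohenMacaulayLocalRing (Localization.AtPrime m)

/-- An ideal `I` of a ring `R` is called Cohen–Macaulay if `R / I` is a Cohen–Macaulay ring. -/
def IsCohenMacaulayIdeal {R : Type*} [CommRing R] (I : Ideal R) : Prop :=
  IsCohenMacaulayRing (R ⧸ I)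

/-- `I` has no embedded primes: every associated prime of `R / I` is a minimal prime of `I`. -/
def HasNoEmbeddedPrimes {R : Type*} [CommRing R] (I : Ideal R) : Prop :=
  ∀ p ∈ associatedPrimes R (R ⧸ I), p ∈ I.minimalPrimes

/-- The complex `0 ← S/I ← S ← S^ι₁ ← S^ι₂ ← 0` over the polynomial ring `S = k[x_s : s ∈ σ]`,
with the canonical map `S → S/I` and with the two other maps given by the matrices `A` and `B`,
is a minimal (graded) free resolution of `S/I`: it is exact, it is graded for a suitable choice
of degrees of the basis vectors, and all entries of its matrices lie in the ideal generated
by the variables. -/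
structure IsMinimalFreeResolution {k σ ι₁ ι₂ : Type*} [Field k] [Fintype ι₁] [Fintype ι₂]
    (I : Ideal (MvPolynomial σ k)) (A : Matrix (Fin 1) ι₁ (MvPolynomial σ k))
    (B : Matrix ι₁ ι₂ (MvPolynomial σ k)) : Prop where
  exact_zero : Function.Exact A.mulVecLin
    ((Ideal.Quotient.mkₐ (MvPolynomial σ k) I).toLinearMap ∘ₗ LinearMap.proj (0 : Fin 1))
  exact_one : Function.Exact B.mulVecLin A.mulVecLin
  exact_two : Function.Injective B.mulVecLin
  minimal_one : ∀ i j, A i j ∈ MvPolynomial.idealOfVars σ k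
  minimal_two : ∀ i j, B i j ∈ MvPolynomial.idealOfVars σ k
  graded : ∃ (a : ι₁ → ℕ) (b : ι₂ → ℕ), (∀ i j, (A i j).IsHomogeneous (a j)) ∧
    ∀ i j, B i j = 0 ∨ ∃ d : ℕ, b j = a i + d ∧ (B i j).IsHomogeneous d

open MvPolynomial in
/-- The monomial `x^{e_i} = x_1^t ⋯ x_{i-1}^t x_{i+1}^t ⋯ x_n^t`. -/
noncomputable def gen (k : Type*) [Field k] (n t : ℕ) (i : Fin n) : MvPolynomial (Fin n) k :=
  ∏ j ∈ Finset.univ.erase i, X j ^ t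

/-- The ideal `I_{n,t} = ⟨x^{e_1}, …, x^{e_n}⟩` of `k[x_1, …, x_n]`. -/
noncomputable def idealI (k : Type*) [Field k] (n t : ℕ) : Ideal (MvPolynomial (Fin n) k) :=
  Ideal.span (Set.range (gen k n t))

open MvPolynomial in
/-- The ideal `⟨x_i^t, x_j^t⟩` of `k[x_1, …, x_n]`. -/
noncomputable def component (k : Type*) [Field k] (n t : ℕ) (i j : Fin n) :
    Ideal (MvPolynomial (Fin n) k) :=
  Ideal.span {X i ^ t, X j ^ t}

/-- The pairs `(i, j)` of indices with `i < j`. -/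
def indexPairs (n : ℕ) : Finset (Fin n × Fin n) :=
  Finset.univ.filter fun p => p.1 < p.2

open Classical in
/-- The finite set of the ideals `⟨x_i^t, x_j^t⟩` with `i < j`. -/
noncomputable def components (k : Type*) [Field k] (n t : ℕ) :
    Finset (Ideal (MvPolynomial (Fin n) k)) :=
  (indexPairs n).image fun p => component k n t p.1 p.2

/-- The `1 × n` matrix `(x^{e_1} ⋯ x^{e_n})`. -/
noncomputable def matrixA (k : Type*) [Field k] (n t : ℕ) :
    Matrix (Fin 1) (Fin n) (MvPolynomial (Fin n) k) :=
  Matrix.of fun _ j => gen k n t j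

open MvPolynomial in
/-- The `n × (n-1)` matrix whose first row is `(-x_1^t, …, -x_1^t)` and whose remaining rows form
the diagonal matrix with diagonal `x_2^t, …, x_n^t` (indices start at `0` in the code). -/
noncomputable def matrixB (k : Type*) [Field k] (n t : ℕ) :
    Matrix (Fin n) (Fin (n - 1)) (MvPolynomial (Fin n) k) :=
  Matrix.of fun i j =>
    if (i : ℕ) = 0 then -(X i ^ t) else if (i : ℕ) = (j : ℕ) + 1 then X i ^ t else 0

end PowerIdeal

/-!
The ideal `I = I_{n,t}` is a monomial ideal: a monomial lies in it exactly when at most one of its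
exponents is less than `t`, i.e. when of any two exponents one is at least `t`. This is the
decomposition of `I` into the ideals `⟨x_i ^ t, x_j ^ t⟩` (`idealI_eq_iInf_component`). Each of
these is primary with radical `⟨x_i, x_j⟩`, because a polynomial outside `⟨x_i, x_j⟩` is a
nonzerodivisor modulo `⟨x_i, x_j⟩`, and stays one when the exponents of the two generators are
raised (`mem_component_of_mul_mem`). The product of the `x_l ^ t` with `l ≠ i, j` separates the
component of `(i, j)` from all others (`exists_mem_component_of_ne`). Hence the decomposition is
minimal, the associated primes are the ideals `⟨x_i, x_j⟩`, all of them minimal over `I` and of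
height two.

A syzygy `∑ gᵢ uᵢ = 0` of the generators has `x_i ^ t ∣ uᵢ` for every `i`, since `x_i ^ t` divides
all generators except `gᵢ`, to which it is coprime (`X_pow_dvd_of_sum_gen_mul_eq_zero`); this gives
exactness of the resolution. A resolution of length two bounds the projective dimension by two. If
the dimension were smaller, then `I` would be projective and the last map `B` of the resolution
would have a left inverse, which is impossible as its entries lie in the ideal of the variables
(`IsMinimalFreeResolution.projectiveDimension_eq_two`).

For the Cohen–Macaulay property, every maximal ideal `m` of `R = k[x_1, …, x_n]` contains a regular
sequence of length `n`, built by adjoining a monic polynomial for each variable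
(`exists_isWeaklyRegular_mvPolynomial`). By the Rees theorem `Ext^i(R / m, F) = 0` for `i < n` and
`F` finite free and nonzero, so the long exact sequences of the resolution give
`Ext^i(R / m, R / I) = 0` for `i < n - 2`, and by the Rees theorem again `m` contains a regular
sequence on `R / I` of length `n - 2` (`IsMinimalFreeResolution.exists_isRegular_quotient`). On the
other hand `dim R / I ≤ dim R - ht I = n - 2`
(`ringKrullDim_quotient_add_height_le`), while a regular sequence in a Noetherian local ring is
never longer than the dimension, so depth and dimension agree at every maximal ideal.
-/

namespace PowerIdeal

open MvPolynomial

/-! ### Monomial descriptions of the ideals -/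

section Monomials

variable {k : Type*} [Field k] {n t : ℕ}

/-- The exponent vector that vanishes on `s` and has all its other entries equal to `t`. -/
noncomputable def expOff (n t : ℕ) (s : Finset (Fin n)) : Fin n →₀ ℕ :=
  Finsupp.equivFunOnFinite.symm fun j => if j ∈ s then 0 else t

@[simp]
lemma expOff_apply (s : Finset (Fin n)) (j : Fin n) :
    expOff n t s j = if j ∈ s then 0 else t := rfl

lemma gen_eq_monomial (i : Fin n) : gen k n t i = monomial (expOff n t {i}) 1 := by
  rw [monomial_eq, Finsupp.prod_fintype _ _ (fun _ => pow_zero _), C_1, one_mul, gen,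
    ← Finset.mul_prod_erase Finset.univ _ (Finset.mem_univ i)]
  simp only [expOff_apply, Finset.mem_singleton, if_true, pow_zero, one_mul]
  exact Finset.prod_congr rfl fun j hj => by rw [if_neg (Finset.ne_of_mem_erase hj)]

lemma mem_idealI_iff {f : MvPolynomial (Fin n) k} :
    f ∈ idealI k n t ↔ ∀ m ∈ f.support, ∃ i, ∀ j, j ≠ i → t ≤ m j := by
  have h : Set.range (gen k n t) =
      (fun s => monomial s (1 : k)) '' Set.range fun i => expOff n t {i} := by
    rw [← Set.range_comp]
    exact congrArg Set.range (funext gen_eq_monomial)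
  rw [idealI, h, mem_ideal_span_monomial_image]
  refine forall₂_congr fun m _ => ?_
  simp only [Set.exists_range_iff, Finsupp.le_def, expOff_apply, Finset.mem_singleton]
  refine exists_congr fun i => forall_congr' fun j => ?_
  by_cases hj : j = i <;> simp [hj]

lemma mem_component_iff {i j : Fin n} {f : MvPolynomial (Fin n) k} :
    f ∈ component k n t i j ↔ ∀ m ∈ f.support, t ≤ m i ∨ t ≤ m j := by
  have h : ({X i ^ t, X j ^ t} : Set (MvPolynomial (Fin n) k)) =
      (fun s => monomial s (1 : k)) '' {Finsupp.single i t, Finsupp.single j t} := by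
    simp [Set.image_pair, X_pow_eq_monomial]
  rw [component, h, mem_ideal_span_monomial_image]
  simp [Finsupp.single_le_iff]

/-- A monomial lies in every `⟨x_i ^ t, x_j ^ t⟩` exactly when at most one of its exponents is
less than `t`, which is to say that it is a multiple of some generator of `I_{n,t}`. -/
theorem idealI_eq_iInf_component (hn : 0 < n) :
    idealI k n t = ⨅ (i : Fin n) (j : Fin n) (_ : i < j), component k n t i j := by
  ext f
  simp only [Submodule.mem_iInf, mem_component_iff, mem_idealI_iff]
  constructor
  · intro h i j hij m hm
    obtain ⟨l, hl⟩ := h m hm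
    by_cases hi : i = l
    · exact Or.inr (hl j (by rintro rfl; exact hij.ne hi))
    · exact Or.inl (hl i hi)
  · intro h m hm
    by_cases hex : ∃ i, m i < t
    · obtain ⟨i, hi⟩ := hex
      refine ⟨i, fun j hj => ?_⟩
      rcases lt_or_gt_of_ne hj with hlt | hlt
      · exact (h j i hlt m hm).resolve_right (by omega)
      · exact (h i j hlt m hm).resolve_left (by omega)
    · push Not at hex
      exact ⟨⟨0, hn⟩, fun j _ => hex j⟩

lemma idealI_le_component {i j : Fin n} (hij : i ≠ j) : idealI k n t ≤ component k n t i j := by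
  intro f hf
  rw [mem_component_iff]
  intro m hm
  obtain ⟨l, hl⟩ := mem_idealI_iff.mp hf m hm
  by_cases hi : i = l
  · exact Or.inr (hl j (by rintro rfl; exact hij hi))
  · exact Or.inl (hl i hi)

/-! ### The primes generated by two variables -/

/-- The ideal `⟨x_i, x_j⟩`. -/
noncomputable def varIdeal (k : Type*) [Field k] (n : ℕ) (i j : Fin n) :
    Ideal (MvPolynomial (Fin n) k) :=
  Ideal.span (X '' {i, j})

lemma mem_varIdeal_iff {i j : Fin n} {f : MvPolynomial (Fin n) k} :
    f ∈ varIdeal k n i j ↔ ∀ m ∈ f.support, m i ≠ 0 ∨ m j ≠ 0 := by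
  rw [varIdeal, mem_ideal_span_X_image]
  simp

/-- Setting the variables in `s` to zero identifies `⟨x_l : l ∈ s⟩` with the kernel of a ring
homomorphism to a domain. -/
lemma isPrime_span_image_X {σ : Type*} (s : Set σ) :
    (Ideal.span (X '' s : Set (MvPolynomial σ k))).IsPrime := by
  classical
  let φ : MvPolynomial σ k →ₐ[k] MvPolynomial σ k := aeval fun l => if l ∈ s then 0 else X l
  suffices h : Ideal.span (X '' s : Set (MvPolynomial σ k)) = RingHom.ker φ by
    rw [h]
    exact RingHom.ker_isPrime _
  apply le_antisymm
  · rw [Ideal.span_le]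
    rintro _ ⟨l, hl, rfl⟩
    simp [φ, RingHom.mem_ker, hl]
  · intro f hf
    let q := Ideal.Quotient.mkₐ k (Ideal.span (X '' s : Set (MvPolynomial σ k)))
    have hq : q.comp φ = q := by
      refine MvPolynomial.algHom_ext fun l => ?_
      by_cases hl : l ∈ s
      · have : q (X l) = 0 :=
          Ideal.Quotient.eq_zero_iff_mem.mpr (Ideal.subset_span ⟨l, hl, rfl⟩)
        simp [φ, hl, this]
      · simp [φ, hl]
    have h0 : q f = 0 := by
      rw [← hq, AlgHom.comp_apply, RingHom.mem_ker.mp hf, map_zero]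
    exact Ideal.Quotient.eq_zero_iff_mem.mp h0

instance isPrime_varIdeal (i j : Fin n) : (varIdeal k n i j).IsPrime :=
  isPrime_span_image_X _

lemma component_le_varIdeal (ht : t ≠ 0) (i j : Fin n) :
    component k n t i j ≤ varIdeal k n i j := by
  intro f hf
  rw [mem_varIdeal_iff]
  intro m hm
  have := mem_component_iff.mp hf m hm
  omega

lemma radical_component (ht : t ≠ 0) (i j : Fin n) :
    (component k n t i j).radical = varIdeal k n i j := by
  apply le_antisymm
  · exact (isPrime_varIdeal i j).radical_le_iff.mpr (component_le_varIdeal ht i j)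
  · rw [varIdeal, Ideal.span_le, Set.image_pair]
    rintro _ (rfl | rfl)
    · exact ⟨t, Ideal.subset_span (by simp)⟩
    · exact ⟨t, Ideal.subset_span (by simp)⟩

/-- The product of the `x_l ^ t` with `l ≠ i, j` lies in every component other than that of
`(i, j)`, but not in `⟨x_i, x_j⟩`. -/
lemma exists_mem_component_of_ne (p : Fin n × Fin n) (hp : p.1 < p.2) :
    ∃ w : MvPolynomial (Fin n) k, w ∉ varIdeal k n p.1 p.2 ∧
      ∀ q : Fin n × Fin n, q.1 < q.2 → q ≠ p → w ∈ component k n t q.1 q.2 := by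
  refine ⟨monomial (expOff n t {p.1, p.2}) 1, ?_, fun q hq hqp => ?_⟩
  · simp [mem_varIdeal_iff]
  · rw [mem_component_iff]
    intro m hm
    obtain rfl := Finset.mem_singleton.mp (support_monomial_subset hm)
    simp only [expOff_apply, Finset.mem_insert, Finset.mem_singleton]
    by_contra! h
    obtain ⟨h1, h2⟩ := h
    have h1' : q.1 = p.1 ∨ q.1 = p.2 := by
      by_contra hc
      rw [if_neg hc] at h1
      exact lt_irrefl _ h1
    have h2' : q.2 = p.1 ∨ q.2 = p.2 := by
      by_contra hc
      rw [if_neg hc] at h2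
      exact lt_irrefl _ h2
    refine hqp (Prod.ext ?_ ?_) <;> rcases h1' with h | h <;> rcases h2' with h' | h' <;>
      simp only [Fin.lt_def, Fin.ext_iff] at * <;> omega

lemma eq_of_component_le_varIdeal {p q : Fin n × Fin n} (hp : p.1 < p.2) (hq : q.1 < q.2)
    (h : component k n t q.1 q.2 ≤ varIdeal k n p.1 p.2) : q = p := by
  by_contra hne
  obtain ⟨w, hw, hw'⟩ := exists_mem_component_of_ne (k := k) (t := t) p hp
  exact hw (h (hw' q hq hne))

lemma component_injOn (ht : t ≠ 0) :
    Set.InjOn (fun p : Fin n × Fin n => component k n t p.1 p.2) (indexPairs n) := by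
  intro q hq p hp h
  simp only [indexPairs, Finset.coe_filter, Finset.mem_univ, true_and, Set.mem_ofPred_eq] at hp hq
  exact eq_of_component_le_varIdeal hp hq (h.le.trans (component_le_varIdeal ht _ _))

end Monomials

/-! ### Primary decomposition -/

section Primary

/-- If `x` is a nonzerodivisor modulo `J` and `g` is one modulo `J + ⟨x⟩`, then `g` is one modulo
`J + ⟨x ^ a⟩`. -/
lemma mem_sup_span_pow_of_mul_mem {R : Type*} [CommRing R] {J : Ideal R} {x g : R}
    (hx : ∀ f, x * f ∈ J → f ∈ J)
    (hg : ∀ f, g * f ∈ J ⊔ Ideal.span {x} → f ∈ J ⊔ Ideal.span {x}) (a : ℕ) :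
    ∀ f, g * f ∈ J ⊔ Ideal.span {x ^ a} → f ∈ J ⊔ Ideal.span {x ^ a} := by
  have hxa : ∀ a f, x ^ a * f ∈ J → f ∈ J := by
    intro a
    induction a with
    | zero => simp
    | succ a ih => exact fun f hf => hx f (ih _ (by rwa [← mul_assoc, ← pow_succ]))
  induction a with
  | zero => simp [Ideal.span_singleton_one]
  | succ a ih =>
    intro f hf
    have hle : J ⊔ Ideal.span {x ^ (a + 1)} ≤ J ⊔ Ideal.span {x ^ a} :=
      sup_le_sup_left (Ideal.span_singleton_le_span_singleton.mpr (pow_dvd_pow x a.le_succ)) _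
    obtain ⟨u, hu, v, hv, rfl⟩ := Submodule.mem_sup.mp (ih f (hle hf))
    obtain ⟨h, rfl⟩ := Ideal.mem_span_singleton'.mp hv
    obtain ⟨u', hu', v', hv', he⟩ := Submodule.mem_sup.mp hf
    obtain ⟨r, rfl⟩ := Ideal.mem_span_singleton'.mp hv'
    have h1 : g * h - x * r ∈ J := by
      refine hxa a _ ?_
      have : x ^ a * (g * h - x * r) = u' - g * u := by
        linear_combination -he
      rw [this]
      exact J.sub_mem hu' (J.mul_mem_left _ hu)
    have h2 : h ∈ J ⊔ Ideal.span {x} := by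
      refine hg h ?_
      rw [← sub_add_cancel (g * h) (x * r)]
      exact Ideal.add_mem _ (Ideal.mem_sup_left h1)
        (Ideal.mem_sup_right (Ideal.mul_mem_right _ _ (Ideal.mem_span_singleton_self x)))
    obtain ⟨u'', hu'', v'', hv'', rfl⟩ := Submodule.mem_sup.mp h2
    obtain ⟨s, rfl⟩ := Ideal.mem_span_singleton'.mp hv''
    rw [show u + (u'' + s * x) * x ^ a = (u + x ^ a * u'') + s * x ^ (a + 1) by ring]
    exact Ideal.add_mem _ (Ideal.mem_sup_left (J.add_mem hu (J.mul_mem_left _ hu'')))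
      (Ideal.mem_sup_right (Ideal.mul_mem_left _ _ (Ideal.mem_span_singleton_self _)))

variable {k : Type*} [Field k] {n t : ℕ}

lemma not_X_dvd_X {i j : Fin n} (hij : i ≠ j) : ¬ (X i : MvPolynomial (Fin n) k) ∣ X j := by
  rw [X_dvd_X]
  exact hij

/-- A polynomial outside `⟨x_i, x_j⟩` is a nonzerodivisor modulo `⟨x_i ^ t, x_j ^ t⟩`: it is one
modulo `⟨x_i, x_j⟩`, and the two exponents can be raised one after the other. -/
lemma mem_component_of_mul_mem {i j : Fin n} (hij : i ≠ j) {f g : MvPolynomial (Fin n) k}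
    (hg : g ∉ varIdeal k n i j) (h : g * f ∈ component k n t i j) :
    f ∈ component k n t i j := by
  have hvar : varIdeal k n i j = Ideal.span {X j} ⊔ Ideal.span {X i} := by
    rw [varIdeal, Set.image_pair, Ideal.span_insert, sup_comm]
  have hcomp : component k n t i j = Ideal.span {X i ^ t} ⊔ Ideal.span {X j ^ t} := by
    rw [component, Ideal.span_insert]
  have h1 := mem_sup_span_pow_of_mul_mem (J := Ideal.span {(X j : MvPolynomial (Fin n) k)})
    (x := X i) (g := g)
    (fun f hf => by
      rw [Ideal.mem_span_singleton] at hf ⊢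
      exact ((X_prime (i := j)).dvd_or_dvd hf).resolve_left (not_X_dvd_X hij.symm))
    (fun f hf => by
      rw [← hvar] at hf ⊢
      exact ((isPrime_varIdeal i j).mem_or_mem hf).resolve_left hg) t
  have h2 := mem_sup_span_pow_of_mul_mem (J := Ideal.span {(X i ^ t : MvPolynomial (Fin n) k)})
    (x := X j) (g := g)
    (fun f hf => by
      rw [Ideal.mem_span_singleton] at hf ⊢
      exact (X_prime (i := i)).pow_dvd_of_dvd_mul_left t (not_X_dvd_X hij) hf)
    (fun f hf => by
      rw [sup_comm] at hf ⊢
      exact h1 f hf) t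
  rw [hcomp] at h ⊢
  exact h2 f h

lemma isPrimary_component (ht : t ≠ 0) {i j : Fin n} (hij : i ≠ j) :
    (component k n t i j).IsPrimary := by
  refine Ideal.isPrimary_iff.mpr ⟨fun htop => ?_, fun {f g} hfg => ?_⟩
  · exact (isPrime_varIdeal (k := k) i j).ne_top
      (top_le_iff.mp (htop.symm.le.trans (component_le_varIdeal ht i j)))
  · rw [radical_component ht, or_iff_not_imp_right]
    exact fun hg => mem_component_of_mul_mem hij hg (by rwa [mul_comm])

lemma mem_components {J : Ideal (MvPolynomial (Fin n) k)} :
    J ∈ components k n t ↔ ∃ p : Fin n × Fin n, p.1 < p.2 ∧ component k n t p.1 p.2 = J := by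
  simp [components, indexPairs]

theorem isMinimalPrimaryDecomposition_components (hn : 0 < n) (ht : t ≠ 0) :
    Submodule.IsMinimalPrimaryDecomposition (idealI k n t) (components k n t) where
  inf_eq := by
    rw [idealI_eq_iInf_component hn]
    apply le_antisymm
    · refine le_iInf fun i => le_iInf fun j => le_iInf fun hij => ?_
      exact Finset.inf_le (f := id) (mem_components.mpr ⟨(i, j), hij, rfl⟩)
    · refine Finset.le_inf fun J hJ => ?_
      obtain ⟨p, hp, rfl⟩ := mem_components.mp hJ
      exact (iInf_le _ p.1).trans ((iInf_le _ p.2).trans (iInf_le _ hp))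
  primary := by
    intro J hJ
    obtain ⟨p, hp, rfl⟩ := mem_components.mp hJ
    exact isPrimary_component ht hp.ne
  distinct := by
    intro J hJ K hK hJK h
    obtain ⟨p, hp, rfl⟩ := mem_components.mp hJ
    obtain ⟨q, hq, rfl⟩ := mem_components.mp hK
    simp only [Submodule.colon_univ, radical_component ht] at h
    exact hJK (by rw [eq_of_component_le_varIdeal hq hp
      ((component_le_varIdeal (k := k) ht p.1 p.2).trans h.le)])
  minimal := by
    intro J hJ hle
    obtain ⟨p, hp, rfl⟩ := mem_components.mp hJ
    obtain ⟨w, hw, hw'⟩ := exists_mem_component_of_ne (k := k) (t := t) p hp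
    refine hw (component_le_varIdeal ht _ _ (hle ?_))
    rw [Submodule.mem_finsetInf]
    intro K hK
    obtain ⟨hne, hK⟩ := Finset.mem_erase.mp hK
    obtain ⟨q, hq, rfl⟩ := mem_components.mp hK
    exact hw' q hq (by rintro rfl; exact hne rfl)

end Primary

/-! ### Associated primes and height -/

section Height

variable {k : Type*} [Field k] {n t : ℕ}

lemma exists_varIdeal_le_of_idealI_le (hn : 0 < n) (ht : t ≠ 0)
    {P : Ideal (MvPolynomial (Fin n) k)} [hP : P.IsPrime] (h : idealI k n t ≤ P) :
    ∃ p : Fin n × Fin n, p.1 < p.2 ∧ varIdeal k n p.1 p.2 ≤ P := by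
  rw [← (isMinimalPrimaryDecomposition_components hn ht).inf_eq] at h
  obtain ⟨J, hJ, hJP⟩ := hP.inf_le'.mp h
  obtain ⟨p, hp, rfl⟩ := mem_components.mp hJ
  exact ⟨p, hp, radical_component (k := k) ht p.1 p.2 ▸ hP.radical_le_iff.mpr hJP⟩

lemma varIdeal_mem_minimalPrimes (hn : 0 < n) (ht : t ≠ 0) {i j : Fin n} (hij : i < j) :
    varIdeal k n i j ∈ (idealI k n t).minimalPrimes := by
  refine ⟨⟨isPrime_varIdeal i j,
    (idealI_le_component hij.ne).trans (component_le_varIdeal ht i j)⟩, ?_⟩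
  rintro Q ⟨hQ, hIQ⟩ hle
  obtain ⟨p, hp, hpQ⟩ := exists_varIdeal_le_of_idealI_le hn ht hIQ
  rwa [eq_of_component_le_varIdeal (p := (i, j)) hij hp
    ((component_le_varIdeal ht _ _).trans (hpQ.trans hle))] at hpQ

theorem hasNoEmbeddedPrimes_idealI (hn : 0 < n) (ht : t ≠ 0) :
    HasNoEmbeddedPrimes (idealI k n t) := by
  rintro P ⟨hP, x, hx⟩
  obtain ⟨y, rfl⟩ := Ideal.Quotient.mk_surjective x
  have hcolon : (⊥ : Submodule (MvPolynomial (Fin n) k) _).colon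
      {Ideal.Quotient.mk (idealI k n t) y} = (idealI k n t).colon {y} := by
    ext r
    rw [Submodule.mem_colon_singleton, Submodule.mem_colon_singleton, Submodule.mem_bot,
      smul_eq_mul, ← Ideal.Quotient.eq_zero_iff_mem, map_mul]
    rfl
  rw [hcolon] at hx
  have hmem : P ∈ (idealI k n t).associatedPrimes := ⟨hP, y, hx⟩
  rw [← (isMinimalPrimaryDecomposition_components hn ht).image_radical_eq_associated_primes]
    at hmem
  obtain ⟨J, hJ, rfl⟩ := hmem
  obtain ⟨p, hp, rfl⟩ := mem_components.mp hJ
  simp only [Submodule.colon_univ, radical_component ht]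
  exact varIdeal_mem_minimalPrimes hn ht hp

lemma height_varIdeal {i j : Fin n} (hij : i ≠ j) : (varIdeal k n i j).height = 2 := by
  apply le_antisymm
  · have h := Ideal.height_le_card_of_mem_minimalPrimes_span
      (s := (X '' {i, j} : Set (MvPolynomial (Fin n) k))) (Set.toFinite _)
      (p := varIdeal k n i j) (by
        rw [← varIdeal, Ideal.minimalPrimes_eq_subsingleton_self]
        rfl)
    refine h.trans ?_
    rw [Set.image_pair]
    exact_mod_cast (Set.ncard_insert_le _ _).trans (by rw [Set.ncard_singleton])
  · have hpr : (Ideal.span {(X i : MvPolynomial (Fin n) k)}).IsPrime :=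
      (Ideal.span_singleton_prime (X_ne_zero i)).mpr X_prime
    have hlt1 : (⊥ : Ideal (MvPolynomial (Fin n) k)) < Ideal.span {X i} :=
      bot_lt_iff_ne_bot.mpr (by simp [X_ne_zero])
    have hlt2 : Ideal.span {(X i : MvPolynomial (Fin n) k)} < varIdeal k n i j := by
      refine lt_of_le_of_ne (Ideal.span_mono (by simp [Set.image_pair])) fun h => ?_
      have : (X j : MvPolynomial (Fin n) k) ∈ Ideal.span {X i} := by
        rw [h]
        exact Ideal.subset_span ⟨j, by simp, rfl⟩
      exact not_X_dvd_X hij (Ideal.mem_span_singleton.mp this)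
    have h1 := Ideal.height_add_one_le_of_lt_of_isPrime hlt1
    have h2 := Ideal.height_add_one_le_of_lt_of_isPrime hlt2
    rw [Ideal.height_bot, zero_add] at h1
    calc (2 : ℕ∞) = 1 + 1 := by norm_num
      _ ≤ _ := by gcongr
      _ ≤ _ := h2

theorem height_idealI (hn : 2 ≤ n) (ht : t ≠ 0) : (idealI k n t).height = 2 := by
  apply le_antisymm
  · have hij : (⟨0, by omega⟩ : Fin n) ≠ ⟨1, by omega⟩ := by simp
    rw [← height_varIdeal (k := k) hij]
    exact Ideal.height_mono ((idealI_le_component hij).trans (component_le_varIdeal ht _ _))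
  · rw [Ideal.height_eq_inf_minimalPrimes]
    refine le_iInf₂ fun P hP => ?_
    have := hP.isPrime
    obtain ⟨p, hp, hpP⟩ := exists_varIdeal_le_of_idealI_le (by omega) ht hP.1.2
    rw [← height_varIdeal (k := k) hp.ne]
    exact Ideal.height_mono hpP

end Height

end PowerIdeal

namespace PowerIdeal

open MvPolynomial CategoryTheory

/-! ### The Hilbert–Burch resolution -/

section Resolution

variable {k : Type*} [Field k] {n t : ℕ}

lemma gen_mul_X_pow (i : Fin n) : gen k n t i * X i ^ t = ∏ j, X j ^ t := by
  rw [gen, Finset.prod_erase_mul _ _ (Finset.mem_univ i)]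

lemma X_pow_dvd_gen {i j : Fin n} (hij : i ≠ j) : (X i ^ t : MvPolynomial _ k) ∣ gen k n t j :=
  Finset.dvd_prod_of_mem _ (Finset.mem_erase.mpr ⟨hij, Finset.mem_univ i⟩)

lemma not_X_dvd_gen (i : Fin n) : ¬ (X i : MvPolynomial _ k) ∣ gen k n t i := by
  rw [gen, X_prime.dvd_finsetProd_iff]
  rintro ⟨j, hj, h⟩
  exact not_X_dvd_X (Finset.ne_of_mem_erase hj).symm (X_prime.dvd_of_dvd_pow h)

lemma gen_ne_zero (i : Fin n) : gen k n t i ≠ 0 := fun h => not_X_dvd_gen i (h ▸ dvd_zero (X i))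

lemma matrixA_mulVecLin_apply (v : Fin n → MvPolynomial (Fin n) k) :
    (matrixA k n t).mulVecLin v 0 = ∑ i, gen k n t i * v i := by
  simp [matrixA, Matrix.mulVec, dotProduct]

lemma matrixB_mulVecLin_zero (v : Fin n → MvPolynomial (Fin (n + 1)) k) :
    (matrixB k (n + 1) t).mulVecLin v 0 = -(X 0 ^ t * ∑ j, v j) := by
  simp [matrixB, Matrix.mulVec, dotProduct, Finset.mul_sum]

lemma matrixB_mulVecLin_succ (v : Fin n → MvPolynomial (Fin (n + 1)) k) (i : Fin n) :
    (matrixB k (n + 1) t).mulVecLin v i.succ = X i.succ ^ t * v i := by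
  simp only [matrixB, Matrix.mulVecLin_apply, Matrix.mulVec, dotProduct, Matrix.of_apply]
  refine (Finset.sum_eq_single (i : Fin n) (fun j _ hj => ?_) (by simp)).trans (by simp)
  rw [if_neg (by simp), if_neg, zero_mul]
  simpa [Fin.ext_iff] using Fin.val_ne_of_ne hj.symm

lemma matrixB_mulVecLin_injective :
    Function.Injective (matrixB k (n + 1) t).mulVecLin := by
  rw [injective_iff_map_eq_zero]
  intro v hv
  funext i
  have h := matrixB_mulVecLin_succ (n := n) (t := t) v i
  rw [hv, Pi.zero_apply, eq_comm, mul_eq_zero] at h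
  exact h.resolve_left (pow_ne_zero _ (X_ne_zero _))

/-- In a relation `∑ gᵢ uᵢ = 0` between the generators, `x_i ^ t` divides every `g_j` with
`j ≠ i` and is coprime to `gᵢ`, so it divides `uᵢ`. -/
lemma X_pow_dvd_of_sum_gen_mul_eq_zero {u : Fin n → MvPolynomial (Fin n) k}
    (hu : ∑ i, gen k n t i * u i = 0) (i : Fin n) : X i ^ t ∣ u i := by
  refine (X_prime (i := i)).pow_dvd_of_dvd_mul_left t (not_X_dvd_gen (t := t) i) ?_
  rw [← Finset.add_sum_erase _ _ (Finset.mem_univ i), add_eq_zero_iff_eq_neg] at hu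
  rw [hu, dvd_neg]
  exact Finset.dvd_sum fun j hj =>
    (X_pow_dvd_gen (Finset.ne_of_mem_erase hj).symm).mul_right _

lemma exact_matrixB_matrixA :
    Function.Exact (matrixB k (n + 1) t).mulVecLin (matrixA k (n + 1) t).mulVecLin := by
  intro u
  constructor
  · intro hu
    have hu' : ∑ i, gen k (n + 1) t i * u i = 0 := by
      rw [← matrixA_mulVecLin_apply, hu, Pi.zero_apply]
    choose v hv using fun i : Fin n => X_pow_dvd_of_sum_gen_mul_eq_zero hu' i.succ
    refine ⟨v, funext fun i => ?_⟩
    refine Fin.cases ?_ (fun i => ?_) i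
    · rw [matrixB_mulVecLin_zero]
      refine mul_left_cancel₀ (gen_ne_zero (k := k) (t := t) (0 : Fin (n + 1))) ?_
      rw [Fin.sum_univ_succ, add_eq_zero_iff_eq_neg] at hu'
      rw [hu', mul_neg, ← mul_assoc, gen_mul_X_pow, Finset.mul_sum]
      congr 1
      refine Finset.sum_congr rfl fun i _ => ?_
      rw [hv i, ← mul_assoc, gen_mul_X_pow]
    · rw [matrixB_mulVecLin_succ, ← hv i]
  · rintro ⟨v, rfl⟩
    funext i
    rw [Subsingleton.elim i 0, matrixA_mulVecLin_apply, Fin.sum_univ_succ,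
      matrixB_mulVecLin_zero, mul_neg, ← mul_assoc, gen_mul_X_pow, Finset.mul_sum, Pi.zero_apply,
      neg_add_eq_zero]
    refine Finset.sum_congr rfl fun i _ => ?_
    rw [matrixB_mulVecLin_succ, ← mul_assoc, gen_mul_X_pow]

lemma exact_matrixA_quotient :
    Function.Exact (matrixA k n t).mulVecLin
      ((Ideal.Quotient.mkₐ (MvPolynomial (Fin n) k) (idealI k n t)).toLinearMap ∘ₗ
        LinearMap.proj (0 : Fin 1)) := by
  intro y
  have h1 : ((Ideal.Quotient.mkₐ (MvPolynomial (Fin n) k) (idealI k n t)).toLinearMap ∘ₗ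
      LinearMap.proj (0 : Fin 1)) y = Ideal.Quotient.mk (idealI k n t) (y 0) := rfl
  rw [h1, Ideal.Quotient.eq_zero_iff_mem, idealI, Ideal.mem_span_range_iff_exists_fun]
  refine exists_congr fun c => ?_
  rw [funext_iff, Fin.forall_fin_one, matrixA_mulVecLin_apply]
  simp only [mul_comm]

lemma isHomogeneous_gen (i : Fin n) : (gen k n t i).IsHomogeneous ((n - 1) * t) := by
  have h := IsHomogeneous.prod (Finset.univ.erase i) (fun j => (X j ^ t : MvPolynomial (Fin n) k))
    (fun _ => t) (fun j _ => by simpa using (isHomogeneous_X k j).pow t)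
  simpa [gen] using h

lemma X_pow_mem_idealOfVars {σ : Type*} (ht : t ≠ 0) (i : σ) :
    (X i ^ t : MvPolynomial σ k) ∈ idealOfVars σ k :=
  Ideal.pow_mem_of_mem _ (Ideal.subset_span (Set.mem_range_self i)) t (Nat.pos_of_ne_zero ht)

theorem isMinimalFreeResolution_idealI (hn : 2 ≤ n) (ht : t ≠ 0) :
    IsMinimalFreeResolution (idealI k n t) (matrixA k n t) (matrixB k n t) where
  exact_zero := exact_matrixA_quotient
  exact_one := by
    obtain ⟨n, rfl⟩ : ∃ m, n = m + 1 := ⟨n - 1, by omega⟩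
    exact exact_matrixB_matrixA
  exact_two := by
    obtain ⟨n, rfl⟩ : ∃ m, n = m + 1 := ⟨n - 1, by omega⟩
    exact matrixB_mulVecLin_injective
  minimal_one := fun _ j => by
    have : Nontrivial (Fin n) := Fin.nontrivial_iff_two_le.mpr hn
    obtain ⟨l, hl⟩ := exists_ne j
    exact Ideal.mem_of_dvd _ (X_pow_dvd_gen hl) (X_pow_mem_idealOfVars ht l)
  minimal_two := fun i j => by
    simp only [matrixB, Matrix.of_apply]
    split_ifs
    · exact neg_mem (X_pow_mem_idealOfVars ht i)
    · exact X_pow_mem_idealOfVars ht i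
    · exact zero_mem _
  graded := by
    -- the generators have degree `(n - 1) t`, and the relations between them degree `n t`
    refine ⟨fun _ => (n - 1) * t, fun _ => (n - 1) * t + t, fun _ j => isHomogeneous_gen j,
      fun i j => ?_⟩
    have hX : (X i ^ t : MvPolynomial (Fin n) k).IsHomogeneous t := by
      simpa using (isHomogeneous_X k i).pow t
    simp only [matrixB, Matrix.of_apply]
    split_ifs
    · exact Or.inr ⟨t, rfl, hX.neg⟩
    · exact Or.inr ⟨t, rfl, hX⟩
    · exact Or.inl rfl

end Resolution

/-! ### Projective dimension -/

namespace IsMinimalFreeResolution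

variable {k σ : Type*} {ι₁ ι₂ : Type} [Field k] [Fintype ι₁] [Fintype ι₂]
  {I : Ideal (MvPolynomial σ k)} {A : Matrix (Fin 1) ι₁ (MvPolynomial σ k)}
  {B : Matrix ι₁ ι₂ (MvPolynomial σ k)}

lemma mulVecLin_apply_mem (h : IsMinimalFreeResolution I A B) (v : ι₁ → MvPolynomial σ k) :
    A.mulVecLin v 0 ∈ I :=
  Ideal.Quotient.eq_zero_iff_mem.mp ((h.exact_zero _).mpr ⟨v, rfl⟩)

/-- The map from the first free module of the resolution onto the ideal that it resolves. -/
noncomputable def toIdeal (h : IsMinimalFreeResolution I A B) :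
    (ι₁ → MvPolynomial σ k) →ₗ[MvPolynomial σ k] I :=
  LinearMap.codRestrict I (LinearMap.proj (0 : Fin 1) ∘ₗ A.mulVecLin) h.mulVecLin_apply_mem

lemma toIdeal_surjective (h : IsMinimalFreeResolution I A B) : Function.Surjective h.toIdeal := by
  rintro ⟨f, hf⟩
  obtain ⟨v, hv⟩ := (h.exact_zero fun _ => f).mp (Ideal.Quotient.eq_zero_iff_mem.mpr hf)
  exact ⟨v, Subtype.ext (congrFun hv 0)⟩

lemma exact_toIdeal (h : IsMinimalFreeResolution I A B) :
    Function.Exact B.mulVecLin h.toIdeal := by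
  intro v
  rw [← h.exact_one v, Subtype.ext_iff, funext_iff, Fin.forall_fin_one]
  rfl

/-- The short exact sequence `0 → S^ι₂ → S^ι₁ → I → 0` given by a resolution of `S / I`. -/
noncomputable def idealShortComplex (h : IsMinimalFreeResolution I A B) :
    ShortComplex (ModuleCat (MvPolynomial σ k)) :=
  ModuleCat.shortComplexOfCompEqZero B.mulVecLin h.toIdeal h.exact_toIdeal.linearMap_comp_eq_zero

lemma idealShortComplex_shortExact (h : IsMinimalFreeResolution I A B) :
    h.idealShortComplex.ShortExact :=
  ModuleCat.shortComplex_shortExact _ h.exact_toIdeal h.exact_two h.toIdeal_surjective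

end IsMinimalFreeResolution

/-- The short exact sequence `0 → I → R → R / I → 0`. -/
noncomputable def quotientShortComplex {R : Type*} [CommRing R] (I : Ideal R) :
    ShortComplex (ModuleCat R) :=
  ModuleCat.shortComplexOfCompEqZero (Submodule.subtype I) (Submodule.mkQ I)
    (LinearMap.exact_subtype_mkQ I).linearMap_comp_eq_zero

lemma quotientShortComplex_shortExact {R : Type*} [CommRing R] (I : Ideal R) :
    (quotientShortComplex I).ShortExact :=
  ModuleCat.shortComplex_shortExact _ (LinearMap.exact_subtype_mkQ I)
    (Submodule.subtype_injective I) (Submodule.mkQ_surjective I)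

lemma one_notMem_idealOfVars {k σ : Type*} [Field k] :
    (1 : MvPolynomial σ k) ∉ idealOfVars σ k := by
  intro h
  have hle : idealOfVars σ k ≤ RingHom.ker (constantCoeff (R := k) (σ := σ)) := by
    rw [idealOfVars, Ideal.span_le]
    rintro _ ⟨i, rfl⟩
    simp [RingHom.mem_ker]
  simpa [RingHom.mem_ker] using hle h

namespace IsMinimalFreeResolution

variable {k σ : Type*} {ι₁ ι₂ : Type} [Field k] [Fintype ι₁] [Fintype ι₂]
  {I : Ideal (MvPolynomial σ k)} {A : Matrix (Fin 1) ι₁ (MvPolynomial σ k)}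
  {B : Matrix ι₁ ι₂ (MvPolynomial σ k)}

/-- A left inverse of `B` would map a column of `B`, whose entries lie in the ideal of the
variables, to a basis vector. -/
lemma not_leftInverse_mulVecLin [Nonempty ι₂] (h : IsMinimalFreeResolution I A B)
    (r : (ι₁ → MvPolynomial σ k) →ₗ[MvPolynomial σ k] (ι₂ → MvPolynomial σ k))
    (hr : r ∘ₗ B.mulVecLin = LinearMap.id) : False := by
  classical
  obtain ⟨j⟩ := ‹Nonempty ι₂›
  have h1 : r (B.mulVecLin (Pi.single j 1)) j = 1 := by
    rw [← LinearMap.comp_apply, hr, LinearMap.id_apply, Pi.single_eq_same]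
  refine one_notMem_idealOfVars (k := k) (σ := σ) ?_
  rw [← h1, Matrix.mulVecLin_apply, Matrix.mulVec_single_one,
    pi_eq_sum_univ' (B.col j), map_sum, Finset.sum_apply]
  refine sum_mem fun i _ => ?_
  rw [map_smul, Pi.smul_apply, smul_eq_mul]
  exact Ideal.mul_mem_right _ _ (h.minimal_two i j)

theorem projectiveDimension_eq_two [Nonempty ι₂] (h : IsMinimalFreeResolution I A B) :
    projectiveDimension (ModuleCat.of (MvPolynomial σ k) (MvPolynomial σ k ⧸ I)) = 2 := by
  have hQ := quotientShortComplex_shortExact I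
  have hI := h.idealShortComplex_shortExact
  have hP0 : Projective (quotientShortComplex I).X₂ :=
    ModuleCat.projective_of_free (Module.Basis.singleton Unit (MvPolynomial σ k))
  have hP1 : Projective h.idealShortComplex.X₂ :=
    ModuleCat.projective_of_free (Pi.basisFun (MvPolynomial σ k) ι₁)
  have hP2 : Projective h.idealShortComplex.X₁ :=
    ModuleCat.projective_of_free (Pi.basisFun (MvPolynomial σ k) ι₂)
  apply le_antisymm
  · refine (projectiveDimension_le_iff _ 2).mpr ?_
    refine (hQ.hasProjectiveDimensionLT_X₃_iff 1 hP0).mpr ?_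
    exact (hI.hasProjectiveDimensionLT_X₃_iff 0 hP1).mpr inferInstance
  · refine (projectiveDimension_ge_iff _ 2).mpr fun hlt => ?_
    have h1 := (hQ.hasProjectiveDimensionLT_X₃_iff 0 hP0).mp hlt
    have hproj : Projective h.idealShortComplex.X₃ :=
      projective_iff_hasProjectiveDimensionLT_one.mpr h1
    let s := hI.splittingOfProjective
    exact h.not_leftInverse_mulVecLin s.r.hom (congrArg ModuleCat.Hom.hom s.f_r)

end IsMinimalFreeResolution

end PowerIdeal

namespace PowerIdeal

open MvPolynomial CategoryTheory RingTheory.Sequence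

/-! ### Regular sequences in polynomial rings -/

section RegularSequences

/-- Multiplication by a monic polynomial is injective modulo an extended ideal. -/
lemma mem_map_C_of_monic_mul_mem {S : Type*} [CommRing S] {J : Ideal S} {f g : Polynomial S}
    (hf : f.Monic) (h : f * g ∈ J.map Polynomial.C) : g ∈ J.map Polynomial.C := by
  have hker : RingHom.ker (Polynomial.mapRingHom (Ideal.Quotient.mk J)) = J.map Polynomial.C := by
    rw [Polynomial.ker_mapRingHom, Ideal.mk_ker]
  rw [← hker, RingHom.mem_ker] at h ⊢
  rw [map_mul, Polynomial.coe_mapRingHom] at h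
  exact (hf.map _).mul_right_eq_zero_iff.mp h

/-- Over a Jacobson ring `S`, the residue ring of a maximal ideal `P` of `S[X]` is integral over
`S`, so `P` contains a monic polynomial; it extends any regular sequence of `S`. -/
lemma exists_isWeaklyRegular_polynomial {S : Type*} [CommRing S] [IsJacobsonRing S]
    (P : Ideal (Polynomial S)) [P.IsMaximal] {rs : List S} (hrs : IsWeaklyRegular S rs)
    (hmem : ∀ r ∈ rs, r ∈ P.comap Polynomial.C) :
    ∃ rs' : List (Polynomial S), rs'.length = rs.length + 1 ∧ (∀ r ∈ rs', r ∈ P) ∧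
      IsWeaklyRegular (Polynomial S) rs' := by
  obtain ⟨f, hf, hfP⟩ := Polynomial.quotient_mk_comp_C_isIntegral_of_isJacobsonRing P
    (Ideal.Quotient.mk P Polynomial.X)
  rw [← Polynomial.hom_eval₂, Polynomial.eval₂_C_X, Ideal.Quotient.eq_zero_iff_mem] at hfP
  refine ⟨rs.map (algebraMap S (Polynomial S)) ++ [f], by simp, ?_, ?_⟩
  · intro r hr
    rcases List.mem_append.mp hr with hr | hr
    · obtain ⟨s, hs, rfl⟩ := List.mem_map.mp hr
      exact hmem s hs
    · rwa [List.mem_singleton.mp hr]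
  · rw [isWeaklyRegular_append_iff, isWeaklyRegular_singleton_iff]
    refine ⟨hrs.of_flat, ?_⟩
    rw [isSMulRegular_quotient_iff_mem_of_smul_mem]
    intro g hg
    rw [smul_eq_mul, Ideal.mul_top, ← Ideal.map_ofList, Polynomial.algebraMap_eq] at hg ⊢
    exact mem_map_C_of_monic_mul_mem hf hg

lemma exists_isWeaklyRegular_of_ringEquiv {R S : Type*} [CommRing R] [CommRing S] (e : R ≃+* S)
    (m : Ideal R) {rs : List S} (hrs : IsWeaklyRegular S rs)
    (hmem : ∀ r ∈ rs, r ∈ m.comap (e.symm : S →+* R)) :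
    ∃ rs' : List R, rs'.length = rs.length ∧ (∀ r ∈ rs', r ∈ m) ∧ IsWeaklyRegular R rs' := by
  refine ⟨rs.map e.symm, by simp, ?_, ?_⟩
  · intro r hr
    obtain ⟨s, hs, rfl⟩ := List.mem_map.mp hr
    exact hmem s hs
  · refine (AddEquiv.isWeaklyRegular_congr (e := e.symm.toAddEquiv) ?_).mp hrs
    rw [List.forall₂_map_right_iff, List.forall₂_same]
    intro r _ x
    simp

/-- Every maximal ideal of a polynomial ring in `n` variables over a field contains a regular
sequence of length `n`. -/
theorem exists_isWeaklyRegular_mvPolynomial (k : Type*) [Field k] (n : ℕ)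
    (m : Ideal (MvPolynomial (Fin n) k)) [hm : m.IsMaximal] :
    ∃ rs : List (MvPolynomial (Fin n) k), rs.length = n ∧ (∀ r ∈ rs, r ∈ m) ∧
      IsWeaklyRegular (MvPolynomial (Fin n) k) rs := by
  induction n with
  | zero => exact ⟨[], rfl, by simp, IsWeaklyRegular.nil _ _⟩
  | succ n ih =>
    let e := (finSuccEquiv k n).toRingEquiv
    let P : Ideal (Polynomial (MvPolynomial (Fin n) k)) := m.comap (e.symm : _ →+* _)
    have hP : P.IsMaximal := Ideal.comap_isMaximal_of_equiv e.symm
    have hC : (P.comap Polynomial.C).IsMaximal :=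
      Polynomial.isMaximal_comap_C_of_isJacobsonRing P
    obtain ⟨rs, hlen, hmem, hreg⟩ := ih (P.comap Polynomial.C)
    obtain ⟨rs', hlen', hmem', hreg'⟩ := exists_isWeaklyRegular_polynomial P hreg hmem
    obtain ⟨rs'', hlen'', hmem'', hreg''⟩ := exists_isWeaklyRegular_of_ringEquiv e m hreg' hmem'
    exact ⟨rs'', by omega, hmem'', hreg''⟩

end RegularSequences

/-! ### Depth along a free resolution -/

section Depth

universe u

open CategoryTheory.Abelian

lemma subsingleton_ext_X₃ {R : Type u} [CommRing R] {S : ShortComplex (ModuleCat.{u} R)}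
    (hS : S.ShortExact) (N : ModuleCat.{u} R) (i : ℕ) (h₂ : Subsingleton (Ext N S.X₂ i))
    (h₁ : Subsingleton (Ext N S.X₁ (i + 1))) : Subsingleton (Ext N S.X₃ i) :=
  AddCommGrpCat.subsingleton_of_isZero <| ShortComplex.Exact.isZero_of_both_zeros
    (Ext.covariant_sequence_exact₃' N hS i (i + 1) rfl)
    ((AddCommGrpCat.isZero_of_iff_subsingleton.mpr h₂).eq_zero_of_src _)
    ((AddCommGrpCat.isZero_of_iff_subsingleton.mpr h₁).eq_zero_of_tgt _)

lemma smul_top_lt_top_of_surjective {R M N : Type*} [CommRing R] [AddCommGroup M] [Module R M]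
    [AddCommGroup N] [Module R N] {m : Ideal R} (f : M →ₗ[R] N) (hf : Function.Surjective f)
    (h : m • (⊤ : Submodule R N) ≠ ⊤) : m • (⊤ : Submodule R M) < ⊤ := by
  refine lt_top_iff_ne_top.mpr fun htop => h ?_
  have := congrArg (Submodule.map f) htop
  rwa [Submodule.map_smul'', Submodule.map_top, LinearMap.range_eq_top.mpr hf] at this

/-- A regular sequence of `R` is one on every flat module, so the Rees theorem applies to it. -/
lemma subsingleton_ext_of_flat {R : Type u} [CommRing R] [IsNoetherianRing R] {M : Type u}
    [AddCommGroup M] [Module R M] [Module.Finite R M] [Module.Flat R M] {m : Ideal R}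
    (hM : m • (⊤ : Submodule R M) < ⊤) {rs : List R} (hmem : ∀ r ∈ rs, r ∈ m)
    (hrs : IsWeaklyRegular R rs) {i : ℕ} (hi : i < rs.length) :
    Subsingleton (Ext (ModuleCat.of R (R ⧸ m)) (ModuleCat.of R M) i) := by
  refine ModuleCat.subsingleton_ext_of_exists_isRegular m _ ?_ (ModuleCat.of R M) hM rs
    hmem ⟨?_, ?_⟩ i hi
  · rw [Module.support_eq_zeroLocus, Ideal.annihilator_quotient]
  · exact ((TensorProduct.lid R M).isWeaklyRegular_congr rs).mp hrs.isWeaklyRegular_rTensor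
  · refine (lt_of_le_of_lt (Submodule.smul_mono_left ?_) hM).ne'
    rw [Ideal.ofList, Ideal.span_le]
    exact hmem

lemma subsingleton_ext_pi {R : Type u} [CommRing R] [IsNoetherianRing R] {ι : Type}
    [Finite ι] [Nonempty ι] {m : Ideal R} (hm : m ≠ ⊤) {rs : List R} (hmem : ∀ r ∈ rs, r ∈ m)
    (hrs : IsWeaklyRegular R rs) {i : ℕ} (hi : i < rs.length) :
    Subsingleton (Ext (ModuleCat.of R (R ⧸ m)) (ModuleCat.of R (ι → R)) i) := by
  obtain ⟨l⟩ := ‹Nonempty ι›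
  exact subsingleton_ext_of_flat
    (smul_top_lt_top_of_surjective (LinearMap.proj l) (LinearMap.proj_surjective l) (by simpa))
    hmem hrs hi

/-- If `S / I` has a free resolution of length two, the depth of `S / I` at a maximal ideal `m` is
at least that of `S` minus two: the groups `Ext^i(S / m, -)` that vanish on free modules for
`i < d + 2` vanish on `S / I` for `i < d`. -/
theorem IsMinimalFreeResolution.exists_isRegular_quotient {k : Type u} {σ ι₁ ι₂ : Type} [Field k]
    [Finite σ] [Fintype ι₁] [Fintype ι₂] [Nonempty ι₁] [Nonempty ι₂]
    {I : Ideal (MvPolynomial σ k)} {A : Matrix (Fin 1) ι₁ (MvPolynomial σ k)}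
    {B : Matrix ι₁ ι₂ (MvPolynomial σ k)} (h : IsMinimalFreeResolution I A B)
    {m : Ideal (MvPolynomial σ k)} (hm : m ≠ ⊤) (hI : I ≤ m) {d : ℕ}
    {rs : List (MvPolynomial σ k)} (hlen : rs.length = d + 2) (hmem : ∀ r ∈ rs, r ∈ m)
    (hrs : IsWeaklyRegular (MvPolynomial σ k) rs) :
    ∃ rs' : List (MvPolynomial σ k), rs'.length = d ∧ (∀ r ∈ rs', r ∈ m) ∧
      IsWeaklyRegular (MvPolynomial σ k ⧸ I) rs' := by
  have hext : ∀ i < d, Subsingleton (Ext (ModuleCat.of _ (MvPolynomial σ k ⧸ m))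
      (ModuleCat.of (MvPolynomial σ k) (MvPolynomial σ k ⧸ I)) i) := fun i hi =>
    subsingleton_ext_X₃ (quotientShortComplex_shortExact I) _ i
      (subsingleton_ext_of_flat (by simpa using hm.lt_top) hmem hrs (by omega)) <|
      subsingleton_ext_X₃ h.idealShortComplex_shortExact _ (i + 1)
        (subsingleton_ext_pi hm hmem hrs (by omega))
        (subsingleton_ext_pi hm hmem hrs (by omega))
  have hlt : m • (⊤ : Submodule (MvPolynomial σ k) (MvPolynomial σ k ⧸ I)) < ⊤ :=
    smul_top_lt_top_of_surjective (Submodule.factor hI) (Submodule.factor_surjective hI) (by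
        have : Nontrivial (MvPolynomial σ k ⧸ m) := Ideal.Quotient.nontrivial_iff.mpr hm
        refine ((Submodule.smul_le.mpr fun r hr x _ => ?_).trans_lt bot_lt_top).ne
        obtain ⟨y, rfl⟩ := Ideal.Quotient.mk_surjective x
        exact Ideal.Quotient.eq_zero_iff_mem.mpr (m.mul_mem_right y hr))
  obtain ⟨rs', hlen', hmem', hreg'⟩ := ModuleCat.exists_isRegular_of_exists_subsingleton_ext m d
    (ModuleCat.of _ (MvPolynomial σ k ⧸ I)) hlt (ModuleCat.of _ (MvPolynomial σ k ⧸ m))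
    (by rw [Module.support_eq_zeroLocus, Ideal.annihilator_quotient]) hext
  exact ⟨rs', hlen', hmem', hreg'.toIsWeaklyRegular⟩

end Depth

/-! ### Dimension and the Cohen–Macaulay property -/

section CohenMacaulay

/-- A chain of primes over `I` can be extended downwards by a chain below its least member, whose
height is at least that of `I`. -/
lemma ringKrullDim_quotient_add_height_le {R : Type*} [CommRing R] {I : Ideal R} (hI : I ≠ ⊤) :
    ringKrullDim (R ⧸ I) + I.height ≤ ringKrullDim R := by
  have hne : Nonempty (PrimeSpectrum.zeroLocus (I : Set R)) :=
    (Set.nonempty_iff_ne_empty.mpr (PrimeSpectrum.zeroLocus_empty_iff_eq_top.not.mpr hI)).to_subtype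
  have hne' : Nonempty (PrimeSpectrum R) := hne.map Subtype.val
  rw [ringKrullDim_quotient, Order.krullDim_eq_iSup_coheight_of_nonempty, ringKrullDim,
    Order.krullDim_eq_iSup_height_add_coheight_of_nonempty, ← WithBot.coe_add, WithBot.coe_le_coe,
    ENat.iSup_add]
  refine iSup_le fun P => le_iSup_of_le P.1 ?_
  rw [add_comm]
  refine add_le_add ?_ ?_
  · rw [← PrimeSpectrum.height_eq_orderHeight]
    exact Ideal.height_mono P.2
  · exact Order.coheight_le_coheight_apply_of_strictMono Subtype.val (fun _ _ h => h) P

/-- Dividing out a regular sequence lowers the dimension by its length, and leaves a nonzero ring,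
whose dimension is at least zero. -/
lemma localDepth_le_ringKrullDim (A : Type*) [CommRing A] [IsLocalRing A] [IsNoetherianRing A] :
    (localDepth A : WithBot ℕ∞) ≤ ringKrullDim A := by
  have hne : ∀ (R : Type _) [CommRing R] [Nontrivial R], ringKrullDim R ≠ ⊥ := fun R _ _ =>
    ((WithBot.bot_lt_coe 0).trans_le ringKrullDim_nonneg_of_nontrivial).ne'
  obtain ⟨D, hD⟩ := WithBot.ne_bot_iff_exists.mp (hne A)
  rw [← hD, WithBot.coe_le_coe, localDepth]
  refine iSup₂_le fun rs hrs => ?_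
  have hlen := ringKrullDim_add_length_eq_ringKrullDim_of_isRegular rs hrs.2
  have : Nontrivial (A ⧸ Ideal.ofList rs) := Ideal.Quotient.nontrivial_iff.mpr fun h =>
    hrs.2.2 (by simp [h])
  obtain ⟨E, hE⟩ := WithBot.ne_bot_iff_exists.mp (hne (A ⧸ Ideal.ofList rs))
  rw [← hD, ← hE] at hlen
  have hlen' : E + (rs.length : ℕ∞) = D := by exact_mod_cast hlen
  rw [← hlen']
  exact le_add_self

/-- A quotient of dimension at most `d` that has a regular sequence of length `d` in each maximal
ideal is Cohen–Macaulay. -/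
theorem isCohenMacaulayIdeal_of_exists_isWeaklyRegular {R : Type*} [CommRing R]
    [IsNoetherianRing R] {I : Ideal R} {d : ℕ} (hdim : ringKrullDim (R ⧸ I) ≤ d)
    (h : ∀ m : Ideal R, m.IsMaximal → I ≤ m → ∃ rs : List R, rs.length = d ∧
      (∀ r ∈ rs, r ∈ m) ∧ IsWeaklyRegular (R ⧸ I) rs) :
    IsCohenMacaulayIdeal I where
  noetherian := inferInstance
  localization m hm := by
    refine ⟨IsLocalization.isNoetherianRing m.primeCompl _ inferInstance, ?_⟩
    have := IsLocalization.isNoetherianRing m.primeCompl (Localization.AtPrime m) inferInstance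
    refine le_antisymm (localDepth_le_ringKrullDim _) ?_
    have hle : ringKrullDim (Localization.AtPrime m) ≤ d := by
      rw [IsLocalization.AtPrime.ringKrullDim_eq_height m]
      exact (Ideal.height_le_ringKrullDim_of_ne_top hm.ne_top).trans hdim
    refine hle.trans ?_
    obtain ⟨rs, hlen, hmem, hreg⟩ := h (m.comap (Ideal.Quotient.mk I))
      (Ideal.comap_isMaximal_of_surjective _ Ideal.Quotient.mk_surjective) (by
        intro x hx
        rw [Ideal.mem_comap, Ideal.Quotient.eq_zero_iff_mem.mpr hx]
        exact m.zero_mem)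
    have hreg' : IsWeaklyRegular (R ⧸ I) (rs.map (algebraMap R (R ⧸ I))) :=
      (isWeaklyRegular_map_algebraMap_iff (R ⧸ I) (R ⧸ I) rs).mpr hreg
    have hmem' : ∀ r ∈ rs.map (algebraMap R (R ⧸ I)), r ∈ m := by
      intro r hr
      obtain ⟨s, hs, rfl⟩ := List.mem_map.mp hr
      exact hmem s hs
    have hloc := hreg'.isRegular_of_isLocalization_of_mem (Localization.AtPrime m) m hmem'
    rw [← hlen]
    refine WithBot.coe_le_coe.mpr (le_iSup₂_of_le _ ⟨?_, hloc⟩ (by simp))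
    intro r hr
    obtain ⟨s, hs, rfl⟩ := List.mem_map.mp hr
    exact (IsLocalization.AtPrime.to_map_mem_maximal_iff _ m s).mpr (hmem' s hs)

theorem isCohenMacaulayIdeal_idealI {k : Type*} [Field k] {n t : ℕ} (hn : 2 ≤ n) (ht : t ≠ 0) :
    IsCohenMacaulayIdeal (idealI k n t) := by
  obtain ⟨d, rfl⟩ : ∃ d, n = d + 2 := ⟨n - 2, by omega⟩
  have hheight := height_idealI (k := k) hn ht
  have hne : idealI k (d + 2) t ≠ ⊤ := by
    rintro h
    simp [h] at hheight
  refine isCohenMacaulayIdeal_of_exists_isWeaklyRegular (d := d) ?_ fun m hm hIm => ?_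
  · have h := ringKrullDim_quotient_add_height_le hne
    rw [hheight, MvPolynomial.ringKrullDim_of_isNoetherianRing, ringKrullDim_eq_zero_of_field] at h
    rw [zero_add, Nat.card_fin, Nat.cast_add] at h
    exact (ENat.WithBot.add_le_add_natCast_right_iff (c := 2)).mp h
  · obtain ⟨rs, hlen, hmem, hreg⟩ := exists_isWeaklyRegular_mvPolynomial k (d + 2) m
    have : Nonempty (Fin (d + 2 - 1)) := ⟨⟨0, by omega⟩⟩
    exact (isMinimalFreeResolution_idealI hn ht).exists_isRegular_quotient hm.ne_top hIm hlen hmem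
      hreg

end CohenMacaulay

end PowerIdeal

theorem mainTheorem4 {k : Type*} [Field k] (n t : ℕ) (hn : 3 ≤ n) (ht : 1 ≤ t) :
    -- the minimal primary decomposition, with pairwise distinct components
    (PowerIdeal.idealI k n t =
      ⨅ (i : Fin n) (j : Fin n) (_ : i < j), PowerIdeal.component k n t i j) ∧
    Set.InjOn (fun p : Fin n × Fin n => PowerIdeal.component k n t p.1 p.2)
      (PowerIdeal.indexPairs n) ∧
    Submodule.IsMinimalPrimaryDecomposition (PowerIdeal.idealI k n t)
      (PowerIdeal.components k n t) ∧
    -- no embedded primes, and codimension two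
    PowerIdeal.HasNoEmbeddedPrimes (PowerIdeal.idealI k n t) ∧
    (PowerIdeal.idealI k n t).height = 2 ∧
    -- the minimal free resolution
    PowerIdeal.IsMinimalFreeResolution (PowerIdeal.idealI k n t)
      (PowerIdeal.matrixA k n t) (PowerIdeal.matrixB k n t) ∧
    -- the projective dimension is two, and equals the codimension
    CategoryTheory.projectiveDimension (ModuleCat.of (MvPolynomial (Fin n) k)
      (MvPolynomial (Fin n) k ⧸ PowerIdeal.idealI k n t)) = 2 ∧
    CategoryTheory.projectiveDimension (ModuleCat.of (MvPolynomial (Fin n) k)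
      (MvPolynomial (Fin n) k ⧸ PowerIdeal.idealI k n t)) =
        ((PowerIdeal.idealI k n t).height : WithBot ℕ∞) ∧
    -- Cohen–Macaulayness
    PowerIdeal.IsCohenMacaulayIdeal (PowerIdeal.idealI k n t) := by
  have hn0 : 0 < n := by omega
  have hn2 : 2 ≤ n := by omega
  have ht0 : t ≠ 0 := by omega
  have hres := PowerIdeal.isMinimalFreeResolution_idealI (k := k) hn2 ht0
  have hheight := PowerIdeal.height_idealI (k := k) hn2 ht0
  have : Nonempty (Fin (n - 1)) := ⟨⟨0, by omega⟩⟩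
  have hpd := hres.projectiveDimension_eq_two
  refine ⟨PowerIdeal.idealI_eq_iInf_component hn0, PowerIdeal.component_injOn ht0,
    PowerIdeal.isMinimalPrimaryDecomposition_components hn0 ht0,
    PowerIdeal.hasNoEmbeddedPrimes_idealI hn0 ht0, hheight, hres, hpd, ?_,
    PowerIdeal.isCohenMacaulayIdeal_idealI hn2 ht0⟩
  rw [hpd, hheight]
  rfl
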